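/- \textbf{Setting.} Let $\mathbb Y$ be a finite set with transition matrix $P_{Y'|Y}$, let $P_X$ be a probability measure on a measurable space $\mathbb X$, and put $\mathbb W=\mathbb X\times\mathbb Y$. Given a history $w^t=(w_0,\dots,w_t)$, $w_s=(x_s,y_s)$, the next state $W_{t+1}=(X_{t+1},Y_{t+1})$ has law $P_X\otimes P_{Y'|Y}(\cdot\mid y_t)$; $E[\cdot\mid w^t]$ is the expectation over infinite histories given $W^t=w^t$, and $E_Y[\cdot\mid y]$, $E_X$ are expectations under $P_{Y'|Y}(\cdot\mid y)$ and $P_X$. Let $\gamma\in(0,1)$, $\theta\in(0,+\infty]$, and let $\mathbf c=(c_t)_t$ be a consumption plan of the lender, i.e. $c_t(w^t)$ is a real measurable function of $w^t$, that is bounded: $|c_t(w^t)|\le C<\infty$ for all $t,w^t$. (Feasible plans are bounded, because bond holdings and prices are; nothing else about feasibility is used.) For $y\in\mathbb Y$ let $\mathcal M_y=\{g:\mathbb Y\to[0,\infty):E_Y[g(Y')\mid y]=1\}$ and $\mathcal E[g](y)=E_Y[g(Y')\log g(Y')\mid y]$ (with $0\log 0=0$). An \emph{admissible distortion} is a sequence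 $m=(m_{s+1})_{s\ge0}$ of measurable functions $m_{s+1}(y'\mid w^s)$ with $m_{s+1}(\cdot\mid w^s)\in\mathcal M_{y_s}$ for all $s,w^s$. Write $M_{t+j}/M_t:=\prod_{\tau=t+1}^{t+j}m_\tau(Y_\tau\mid W^{\tau-1})$. If $\theta=+\infty$, read $\theta\cdot0=0$. Real functions $U_t(w^t)$ \emph{satisfy the sequential problem at} $(t,w^t)$ if $$U_t(w^t)=\min_{m}\ \sum_{j=0}^\infty\gamma^jE\Big[\tfrac{M_{t+j}}{M_t}\big\{c_{t+j}(W^{t+j})+\theta\gamma\,\mathcal E[m_{t+j+1}(\cdot\mid W^{t+j})](Y_{t+j})\big\}\,\Big|\,w^t\Big],$$ the minimum being over all admissible distortions and attained (the objective is well defined in $(-\infty,+\infty]$). They \emph{satisfy SP-MA} if this holds at every $(t,w^t)$. They \emph{satisfy FP-MA} if every $U_t$ is measurable, $U_{t+1}(w^t,(\cdot,y'))$ is $P_X$-integrable for all $t,w^t,y'$, and for all $t,w^t$, with attained minimum, $$U_t(w^t)=c_t(w^t)+\gamma\min_{g\in\mathcal M_{y_t}}\Big\{E_Y\big[g(Y')\,\mathcal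 U_{t+1}(w^t,Y')\mid y_t\big]+\theta\,\mathcal E[g](y_t)\Big\},\qquad \mathcal U_{t+1}(w^t,y')=E_X\big[U_{t+1}(w^t,(X,y'))\big].$$ \textbf{Theorem S.1.} (a) If measurable functions $(U_t)_t$ satisfy SP-MA, then they satisfy FP-MA. (b) Let $(\bar U_t)_t$ satisfy FP-MA. If at some $(t,w^t)$ the transversality condition $$\lim_{T\to\infty}\gamma^{T+1}E\Big[\tfrac{M_{t+T+1}}{M_t}\,\bar U_{t+T+1}(W^{t+T+1})\,\Big|\,w^t\Big]=0\quad\text{for every admissible distortion}$$ holds (the expectations being finite), then $\bar U$ satisfies the sequential problem at $(t,w^t)$. In particular, the condition given $w_0$ (the case $t=0$) makes $\bar U_0(w_0)$ the sequential value at $w_0$; and if the condition holds at every $(t,w^t)$, then $(\bar U_t)_t$ satisfies SP-MA. -/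

import Mathlib

open MeasureTheory ProbabilityTheory Filter Topology
open scoped ENNReal

namespace MinAgent

/-- Partial histories `w^t = (w_0, …, w_t)` of `W`-valued states. -/
abbrev History (W : Type*) (t : ℕ) : Type _ := (i : Finset.Iic t) → W

/-- The last state `w_t` of the history `w^t`. -/
def History.last {W : Type*} {t : ℕ} (w : History W t) : W :=
  w ⟨t, Finset.mem_Iic.2 le_rfl⟩

/-- The history `(w^t, v)` of length one more. -/
def History.snoc {W : Type*} {t : ℕ} (w : History W t) (v : W) : History W (t + 1) :=
  fun i => if h : i.1 ≤ t then w ⟨i.1, Finset.mem_Iic.2 h⟩ else v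

/-- The partial history `w^t` of an infinite history `w^∞`. -/
def upTo {W : Type*} (t : ℕ) (ω : ℕ → W) : History W t := fun i => ω i.1

theorem measurable_last {W : Type*} [MeasurableSpace W] (t : ℕ) :
    Measurable (History.last : History W t → W) :=
  measurable_pi_apply _

noncomputable section

variable {X Y : Type*} [MeasurableSpace X] [MeasurableSpace Y]

/-- Law of `W_{t+1} = (X_{t+1}, Y_{t+1})` given the history `w^t`: the product of `P_X` and
`P_{Y'|Y}(· | y_t)`. -/
def stepKernel (PX : Measure X) [IsProbabilityMeasure PX] (PY : Kernel Y Y) [IsMarkovKernel PY]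
    (t : ℕ) : Kernel (History (X × Y) t) (X × Y) :=
  Kernel.const _ PX ×ₖ PY.comap (fun w => w.last.2) (measurable_last t).snd

instance instMarkovStepKernel (PX : Measure X) [IsProbabilityMeasure PX] (PY : Kernel Y Y)
    [IsMarkovKernel PY] (t : ℕ) : IsMarkovKernel (stepKernel PX PY t) := by
  unfold stepKernel; infer_instance

/-- Conditional law of the infinite history `W^∞` given `W^t = w^t`. -/
def pathLaw (PX : Measure X) [IsProbabilityMeasure PX] (PY : Kernel Y Y) [IsMarkovKernel PY]
    (t : ℕ) (w : History (X × Y) t) : Measure (ℕ → X × Y) :=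
  Kernel.traj (X := fun _ => X × Y) (stepKernel PX PY) t w

/-- Conditional likelihood ratios at the current state `y`: nonnegative `g` with
`E_Y[g(Y') | y] = 1`. -/
def likelihoodRatios (PY : Kernel Y Y) (y : Y) : Set (Y → ℝ) :=
  {g | (∀ y', 0 ≤ g y') ∧ ∫ y', g y' ∂(PY y) = 1}

/-- Conditional relative entropy `E_Y[g(Y') log g(Y') | y]` (with `0 log 0 = 0`). -/
def relEntropy (PY : Kernel Y Y) (g : Y → ℝ) (y : Y) : ℝ :=
  ∫ y', g y' * Real.log (g y') ∂(PY y)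

/-- Admissible sequences of conditional likelihood ratios. Here `m s w` stands for
`m_{s+1}(· | w^s)` with `w = w^s`. -/
structure IsDistortion (PY : Kernel Y Y) (m : (s : ℕ) → History (X × Y) s → Y → ℝ) : Prop where
  measurable : ∀ s, Measurable (fun p : History (X × Y) s × Y => m s p.1 p.2)
  mem : ∀ s w, m s w ∈ likelihoodRatios PY w.last.2

/-- The ratio `M_{t+j} / M_t = ∏_{τ=t+1}^{t+j} m_τ` along an infinite history. -/
def cumRatio (m : (s : ℕ) → History (X × Y) s → Y → ℝ) (t j : ℕ) (ω : ℕ → X × Y) : ℝ :=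
  ∏ i ∈ Finset.range j, m (t + i) (upTo (t + i) ω) (ω (t + i + 1)).2

/-- Expectation of an extended-real random variable: `E[f⁺] - E[f⁻]`. -/
def extExpect {Ω : Type*} [MeasurableSpace Ω] (μ : Measure Ω) (f : Ω → EReal) : EReal :=
  ((∫⁻ ω, (f ω).toENNReal ∂μ : ℝ≥0∞) : EReal) - ((∫⁻ ω, (-f ω).toENNReal ∂μ : ℝ≥0∞) : EReal)

/-- Period payoff `c_s(w^s) + θ γ ℰ[m_{s+1}(· | w^s)](y_s)`, with `∞ · 0 = 0` if `θ = ∞`. -/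
def payoff (PY : Kernel Y Y) (γ : ℝ) (θ : ℝ≥0∞) (c : (s : ℕ) → History (X × Y) s → ℝ)
    (m : (s : ℕ) → History (X × Y) s → Y → ℝ) (s : ℕ) (w : History (X × Y) s) : EReal :=
  (c s w : EReal) + (θ : EReal) * ((γ * relEntropy PY (m s w) w.last.2 : ℝ) : EReal)

/-- The objective of the sequential problem at the history `w^t`,
`∑_{j ≥ 0} γ^j E[(M_{t+j} / M_t) (c_{t+j} + θ γ ℰ[m_{t+j+1}](Y_{t+j})) | w^t]`.
For bounded `c` the partial sums converge in `(-∞, ∞]`, so `limsup` is their limit. -/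
def seqObjective (PX : Measure X) [IsProbabilityMeasure PX] (PY : Kernel Y Y) [IsMarkovKernel PY]
    (γ : ℝ) (θ : ℝ≥0∞) (c : (s : ℕ) → History (X × Y) s → ℝ)
    (m : (s : ℕ) → History (X × Y) s → Y → ℝ) (t : ℕ) (w : History (X × Y) t) : EReal :=
  limsup (fun n : ℕ => ∑ j ∈ Finset.range n, ((γ ^ j : ℝ) : EReal) *
    extExpect (pathLaw PX PY t w) (fun ω =>
      (cumRatio m t j ω : EReal) * payoff PY γ θ c m (t + j) (upTo (t + j) ω))) atTop

/-- `v` is the (attained) minimum of the sequential problem at the history `w^t`. -/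
def IsSeqValue (PX : Measure X) [IsProbabilityMeasure PX] (PY : Kernel Y Y) [IsMarkovKernel PY]
    (γ : ℝ) (θ : ℝ≥0∞) (c : (s : ℕ) → History (X × Y) s → ℝ)
    (t : ℕ) (w : History (X × Y) t) (v : ℝ) : Prop :=
  IsLeast {a : EReal | ∃ m, IsDistortion PY m ∧ a = seqObjective PX PY γ θ c m t w} (v : EReal)

/-- `U` satisfies the sequential problem of the minimizing agent. -/
def SatisfiesSP (PX : Measure X) [IsProbabilityMeasure PX] (PY : Kernel Y Y) [IsMarkovKernel PY]
    (γ : ℝ) (θ : ℝ≥0∞) (c U : (s : ℕ) → History (X × Y) s → ℝ) : Prop :=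
  ∀ t w, IsSeqValue PX PY γ θ c t w (U t w)

/-- The continuation utility `E_X[U_{t+1}(w^t, X_{t+1}, y')]`. -/
def contUtility (PX : Measure X) (U : (s : ℕ) → History (X × Y) s → ℝ)
    (t : ℕ) (w : History (X × Y) t) (y' : Y) : ℝ :=
  ∫ x, U (t + 1) (w.snoc (x, y')) ∂PX

/-- `U` satisfies the functional problem of the minimizing agent: the expectations in the
equation make sense, and `U_t(w^t) = c_t(w^t) + γ min_g {E_Y[g 𝒰_{t+1}(w^t, ·) | y_t] + θ ℰ[g](y_t)}`
at every history, where the minimum is attained. -/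
structure SatisfiesFP (PX : Measure X) (PY : Kernel Y Y)
    (γ : ℝ) (θ : ℝ≥0∞) (c U : (s : ℕ) → History (X × Y) s → ℝ) : Prop where
  measurable : ∀ t, Measurable (U t)
  integrable : ∀ t (w : History (X × Y) t) (y' : Y),
    Integrable (fun x => U (t + 1) (w.snoc (x, y'))) PX
  bellman : ∀ t (w : History (X × Y) t), ∃ v : ℝ,
    IsLeast {a : EReal | ∃ g ∈ likelihoodRatios PY w.last.2,
      a = ((∫ y', g y' * contUtility PX U t w y' ∂(PY w.last.2) : ℝ) : EReal)
        + (θ : EReal) * (relEntropy PY g w.last.2 : EReal)} (v : EReal) ∧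
    U t w = c t w + γ * v

/-- The transversality condition given `w^t`: for every admissible distortion the expectations
`E[(M_{t+T+1} / M_t) U_{t+T+1}(W^{t+T+1}) | w^t]` exist and, multiplied by `γ^{T+1}`, tend to 0.
For `t = 0` this is the condition `γ^{T+1} E[M_{T+1} U_{T+1}(W^{T+1}) | w_0] → 0`. -/
def Transversality (PX : Measure X) [IsProbabilityMeasure PX] (PY : Kernel Y Y)
    [IsMarkovKernel PY] (γ : ℝ) (U : (s : ℕ) → History (X × Y) s → ℝ)
    (t : ℕ) (w : History (X × Y) t) : Prop :=
  ∀ m, IsDistortion PY m →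
    (∀ T : ℕ, Integrable
      (fun ω => cumRatio m t (T + 1) ω * U (t + (T + 1)) (upTo (t + (T + 1)) ω))
      (pathLaw PX PY t w)) ∧
    Tendsto (fun T : ℕ => γ ^ (T + 1) *
      ∫ ω, cumRatio m t (T + 1) ω * U (t + (T + 1)) (upTo (t + (T + 1)) ω) ∂(pathLaw PX PY t w))
      atTop (𝓝 0)

end

end MinAgent

/-!
For part (b), write `N_s = U_s - γ E[m_{s+1} U_{s+1} | w^s]` for the net utility under a distortion
`m`. The discounted distorted means of `N_s` telescope, and transversality makes them sum to `U_t`.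
By the functional equation and Gibbs' inequality `N_s` is at most the period payoff under `m`, with
equality when `m_{s+1}` is the exponential tilt of the continuation utility, so `U_t` is the
attained minimum. For part (a), the robust expectation is monotone and translation equivariant,
hence the functional problem is a `γ`-contraction of bounded plans and has a bounded solution. Such
a solution satisfies transversality, so by (b) it attains the sequential value, which is unique.
-/

namespace MinAgent

noncomputable section

section RelativeEntropy

open InformationTheory

lemma mul_klFun_div {a b : ℝ} (hb : b ≠ 0) :
    b * klFun (a / b) = a * Real.log a - a * Real.log b - (a - b) := by
  rcases eq_or_ne a 0 with rfl | ha
  · simp [klFun_zero]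
  · rw [klFun_apply, Real.log_div ha hb]
    field_simp
    ring

variable {Ω : Type*} [MeasurableSpace Ω] {μ : Measure Ω} {g k : Ω → ℝ}

lemma integral_mul_klFun_div (hk : ∀ x, k x ≠ 0) (hgi : Integrable g μ) (hki : Integrable k μ)
    (hgg : Integrable (fun x => g x * Real.log (g x)) μ)
    (hgk : Integrable (fun x => g x * Real.log (k x)) μ) (hgk1 : ∫ x, g x ∂μ = ∫ x, k x ∂μ) :
    ∫ x, k x * klFun (g x / k x) ∂μ =
      ∫ x, g x * Real.log (g x) ∂μ - ∫ x, g x * Real.log (k x) ∂μ := by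
  have hlog : Integrable (fun x => g x * Real.log (g x) - g x * Real.log (k x)) μ := hgg.sub hgk
  have hsub : Integrable (fun x => g x - k x) μ := hgi.sub hki
  simp only [mul_klFun_div (hk _)]
  rw [integral_sub hlog hsub, integral_sub hgg hgk, integral_sub hgi hki, hgk1, sub_self, sub_zero]

variable {Y : Type*} [MeasurableSpace Y] [Finite Y] [MeasurableSingletonClass Y]
  {PY : Kernel Y Y} [IsFiniteKernel PY] {y : Y} {g k : Y → ℝ}

lemma relEntropy_sub_integral_mul_log (hg : g ∈ likelihoodRatios PY y)
    (hk : k ∈ likelihoodRatios PY y) (hk0 : ∀ y', k y' ≠ 0) :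
    relEntropy PY g y - ∫ y', g y' * Real.log (k y') ∂(PY y) =
      ∫ y', k y' * klFun (g y' / k y') ∂(PY y) :=
  (integral_mul_klFun_div hk0 .of_finite .of_finite .of_finite .of_finite
    (hg.2.trans hk.2.symm)).symm

lemma integral_mul_log_le_relEntropy (hg : g ∈ likelihoodRatios PY y)
    (hk : k ∈ likelihoodRatios PY y) (hk0 : ∀ y', k y' ≠ 0) :
    ∫ y', g y' * Real.log (k y') ∂(PY y) ≤ relEntropy PY g y := by
  rw [← sub_nonneg, relEntropy_sub_integral_mul_log hg hk hk0]
  exact integral_nonneg fun y' =>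
    mul_nonneg (hk.1 y') (klFun_nonneg (div_nonneg (hg.1 y') (hk.1 y')))

end RelativeEntropy

section RobustExpectation

variable {Y : Type*} [MeasurableSpace Y] {PY : Kernel Y Y} {θ : ℝ≥0∞} {y : Y} {g u v : Y → ℝ}

/-- The likelihood ratio `exp (-u / θ) / E_Y[exp (-u / θ) | y]` that attains
`min_g {E_Y[g u | y] + θ ℰ[g](y)}`. The factor `1 / θ` is the inverse in `ℝ≥0∞`, hence `0` for
`θ = ∞`, where the ratio is constantly `1`. -/
def worstRatio (PY : Kernel Y Y) (θ : ℝ≥0∞) (u : Y → ℝ) (y y' : Y) : ℝ :=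
  Real.exp (-(θ⁻¹.toReal * u y')) / ∫ z, Real.exp (-(θ⁻¹.toReal * u z)) ∂(PY y)

/-- The value of `min_g {E_Y[g u | y] + θ ℰ[g](y)}`, computed at its minimizer `worstRatio`. For
`θ = ∞` the entropy of `worstRatio` is `0`, so that the value `∞.toReal = 0` is harmless. -/
def robustExpectation (PY : Kernel Y Y) (θ : ℝ≥0∞) (u : Y → ℝ) (y : Y) : ℝ :=
  ∫ y', worstRatio PY θ u y y' * u y' ∂(PY y)
    + θ.toReal * relEntropy PY (worstRatio PY θ u y) y

variable [IsMarkovKernel PY]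

@[simp]
lemma worstRatio_top : worstRatio PY ∞ u y = 1 := by
  funext y'
  simp [worstRatio]

lemma robustExpectation_zero : robustExpectation PY θ 0 y = 0 := by
  simp [robustExpectation, relEntropy, worstRatio]

lemma robustExpectation_sub_worstRatio :
    ((robustExpectation PY θ u y - ∫ y', worstRatio PY θ u y y' * u y' ∂(PY y) : ℝ) : EReal) =
      (θ : EReal) * (relEntropy PY (worstRatio PY θ u y) y : EReal) := by
  rw [robustExpectation, add_sub_cancel_left]
  rcases eq_or_ne θ ∞ with rfl | htop
  · simp [relEntropy]
  · rw [EReal.coe_mul, EReal.coe_ennreal_toReal htop]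

variable [Finite Y] [MeasurableSingletonClass Y]

lemma relEntropy_nonneg (hg : g ∈ likelihoodRatios PY y) : 0 ≤ relEntropy PY g y := by
  simpa using integral_mul_log_le_relEntropy (k := 1) hg (by simp [likelihoodRatios]) (by simp)

lemma ae_eq_one_of_relEntropy_eq_zero (hg : g ∈ likelihoodRatios PY y)
    (h0 : relEntropy PY g y = 0) : g =ᵐ[PY y] 1 := by
  have hkl := relEntropy_sub_integral_mul_log (k := 1) hg (by simp [likelihoodRatios]) (by simp)
  simp only [h0, Pi.one_apply, Real.log_one, mul_zero, integral_zero, sub_zero, div_one,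
    one_mul] at hkl
  have hkl0 := (integral_eq_zero_iff_of_nonneg
    (fun y' => InformationTheory.klFun_nonneg (hg.1 y')) .of_finite).1 hkl.symm
  filter_upwards [hkl0] with y' hy'
  exact (InformationTheory.klFun_eq_zero_iff (hg.1 y')).1 hy'

lemma worstRatio_pos (y' : Y) : 0 < worstRatio PY θ u y y' :=
  div_pos (Real.exp_pos _) (integral_exp_pos .of_finite)

lemma worstRatio_mem_likelihoodRatios : worstRatio PY θ u y ∈ likelihoodRatios PY y := by
  refine ⟨fun y' => (worstRatio_pos y').le, ?_⟩
  simp only [worstRatio]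
  rw [integral_div, div_self (integral_exp_pos .of_finite).ne']

lemma integral_mul_log_worstRatio (hg : g ∈ likelihoodRatios PY y) :
    ∫ y', g y' * Real.log (worstRatio PY θ u y y') ∂(PY y) =
      -(θ⁻¹.toReal * ∫ y', g y' * u y' ∂(PY y))
        - Real.log (∫ z, Real.exp (-(θ⁻¹.toReal * u z)) ∂(PY y)) := by
  set Z := ∫ z, Real.exp (-(θ⁻¹.toReal * u z)) ∂(PY y)
  have hlog : ∀ y', g y' * Real.log (worstRatio PY θ u y y') =
      -(θ⁻¹.toReal * (g y' * u y')) - g y' * Real.log Z := fun y' => by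
    rw [worstRatio, Real.log_div (Real.exp_ne_zero _) (integral_exp_pos .of_finite).ne',
      Real.log_exp]
    ring
  simp only [hlog]
  rw [integral_sub .of_finite .of_finite, integral_neg, integral_const_mul, integral_mul_const,
    hg.2, one_mul]

-- Gibbs' inequality against `worstRatio`, whose logarithm is affine in `u`; the normalizing
-- constant cancels because both ratios have mean one.
lemma relEntropy_worstRatio_add_le (hg : g ∈ likelihoodRatios PY y) :
    relEntropy PY (worstRatio PY θ u y) y + θ⁻¹.toReal *
      (∫ y', worstRatio PY θ u y y' * u y' ∂(PY y) - ∫ y', g y' * u y' ∂(PY y)) ≤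
        relEntropy PY g y := by
  have hle := integral_mul_log_le_relEntropy hg
    (worstRatio_mem_likelihoodRatios (θ := θ) (u := u)) fun y' => (worstRatio_pos y').ne'
  have heq : relEntropy PY (worstRatio PY θ u y) y = _ :=
    integral_mul_log_worstRatio worstRatio_mem_likelihoodRatios
  rw [integral_mul_log_worstRatio hg] at hle
  linarith

lemma robustExpectation_sub_le (hθ : θ ≠ 0) (hg : g ∈ likelihoodRatios PY y) :
    ((robustExpectation PY θ u y - ∫ y', g y' * u y' ∂(PY y) : ℝ) : EReal) ≤
      (θ : EReal) * (relEntropy PY g y : EReal) := by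
  rcases eq_or_ne θ ∞ with rfl | htop
  · rcases (relEntropy_nonneg hg).eq_or_lt with h0 | hpos
    · have hgu : ∫ y', g y' * u y' ∂(PY y) = ∫ y', u y' ∂(PY y) :=
        integral_congr_ae <| (ae_eq_one_of_relEntropy_eq_zero hg h0.symm).mono fun y' hy' => by
          simp [hy']
      simp [robustExpectation, hgu, ← h0]
    · rw [EReal.coe_ennreal_top, EReal.top_mul_coe_of_pos hpos]
      exact le_top
  · have hθ' : 0 < θ.toReal := ENNReal.toReal_pos hθ htop
    have hscaled := mul_le_mul_of_nonneg_left (relEntropy_worstRatio_add_le (u := u) (θ := θ) hg)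
      hθ'.le
    rw [ENNReal.toReal_inv, mul_add, mul_inv_cancel_left₀ hθ'.ne'] at hscaled
    rw [← EReal.coe_ennreal_toReal htop, ← EReal.coe_mul, EReal.coe_le_coe_iff, robustExpectation]
    linarith

lemma isLeast_robustExpectation (hθ : θ ≠ 0) :
    IsLeast {a : EReal | ∃ g ∈ likelihoodRatios PY y,
      a = ((∫ y', g y' * u y' ∂(PY y) : ℝ) : EReal) + (θ : EReal) * (relEntropy PY g y : EReal)}
      (robustExpectation PY θ u y : EReal) := by
  refine ⟨⟨_, worstRatio_mem_likelihoodRatios (θ := θ) (u := u), ?_⟩, ?_⟩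
  · rw [← robustExpectation_sub_worstRatio, ← EReal.coe_add, add_sub_cancel]
  · rintro _ ⟨g, hg, rfl⟩
    rw [← add_sub_cancel (∫ y', g y' * u y' ∂(PY y)) (robustExpectation PY θ u y), EReal.coe_add]
    exact add_le_add_right (robustExpectation_sub_le hθ hg) _

lemma robustExpectation_le_add (hθ : θ ≠ 0) {δ : ℝ} (huv : ∀ y', u y' ≤ v y' + δ) :
    robustExpectation PY θ u y ≤ robustExpectation PY θ v y + δ := by
  have hw := worstRatio_mem_likelihoodRatios (PY := PY) (y := y) (θ := θ) (u := v)
  have hle := robustExpectation_sub_le (u := u) hθ hw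
  rw [← robustExpectation_sub_worstRatio, EReal.coe_le_coe_iff] at hle
  have hint : ∫ y', worstRatio PY θ v y y' * u y' ∂(PY y) ≤
      ∫ y', worstRatio PY θ v y y' * v y' ∂(PY y) + δ :=
    calc ∫ y', worstRatio PY θ v y y' * u y' ∂(PY y)
      _ ≤ ∫ y', (worstRatio PY θ v y y' * v y' + worstRatio PY θ v y y' * δ) ∂(PY y) :=
        integral_mono .of_finite .of_finite fun y' => by
          simpa only [mul_add] using mul_le_mul_of_nonneg_left (huv y') (hw.1 y')
      _ = ∫ y', worstRatio PY θ v y y' * v y' ∂(PY y) + δ := by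
        rw [integral_add .of_finite .of_finite, integral_mul_const, hw.2, one_mul]
  linarith

lemma abs_robustExpectation_sub_le (hθ : θ ≠ 0) {δ : ℝ} (huv : ∀ y', |u y' - v y'| ≤ δ) :
    |robustExpectation PY θ u y - robustExpectation PY θ v y| ≤ δ := by
  have h1 : robustExpectation PY θ u y ≤ robustExpectation PY θ v y + δ :=
    robustExpectation_le_add hθ fun y' => by linarith [(abs_le.1 (huv y')).2]
  have h2 : robustExpectation PY θ v y ≤ robustExpectation PY θ u y + δ :=
    robustExpectation_le_add hθ fun y' => by linarith [(abs_le.1 (huv y')).1]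
  exact abs_le.2 ⟨by linarith, by linarith⟩

end RobustExpectation

section ExtExpect

variable {Ω : Type*} [MeasurableSpace Ω] {μ : Measure Ω}

lemma ereal_coe_sum {ι : Type*} (s : Finset ι) (f : ι → ℝ) :
    ((∑ i ∈ s, f i : ℝ) : EReal) = ∑ i ∈ s, (f i : EReal) :=
  map_sum (⟨⟨Real.toEReal, EReal.coe_zero⟩, EReal.coe_add⟩ : ℝ →+ EReal) f s

lemma extExpect_mono {f g : Ω → EReal} (hfg : ∀ ω, f ω ≤ g ω) :
    extExpect μ f ≤ extExpect μ g := by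
  refine EReal.sub_le_sub ?_ ?_ <;>
    refine EReal.coe_ennreal_le_coe_ennreal_iff.2
      (lintegral_mono fun ω => EReal.toENNReal_le_toENNReal ?_)
  · exact hfg ω
  · exact EReal.neg_le_neg_iff.2 (hfg ω)

lemma extExpect_coe {f : Ω → ℝ} (hf : Integrable f μ) :
    extExpect μ (fun ω => (f ω : EReal)) = ((∫ ω, f ω ∂μ : ℝ) : EReal) := by
  have hneg : ∫⁻ ω, ENNReal.ofReal (-f ω) ∂μ ≠ ∞ := hf.neg.lintegral_lt_top.ne
  rw [integral_eq_lintegral_pos_part_sub_lintegral_neg_part hf, EReal.coe_sub,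
    EReal.coe_ennreal_toReal hf.lintegral_lt_top.ne, EReal.coe_ennreal_toReal hneg]
  simp only [extExpect, ← EReal.coe_neg, EReal.toENNReal_of_ne_top (EReal.coe_ne_top _),
    EReal.toReal_coe]

end ExtExpect

section Histories

variable {W : Type*} {t s : ℕ}

/-- The infinite history that follows `w^t` and then remains in its last state. Composing with it
turns a function of infinite histories that looks at the first `t` steps only into a function of
`w^t`. -/
def History.stopped (w : History W t) : ℕ → W :=
  fun i => w ⟨min i t, Finset.mem_Iic.2 (min_le_right i t)⟩

lemma stopped_upTo_apply (hst : s ≤ t) (ω : ℕ → W) : (upTo t ω).stopped s = ω s := by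
  simp only [History.stopped, upTo, min_eq_left hst]

lemma upTo_stopped_upTo (hst : s ≤ t) (ω : ℕ → W) : upTo s (upTo t ω).stopped = upTo s ω :=
  funext fun i => stopped_upTo_apply ((Finset.mem_Iic.1 i.2).trans hst) ω

lemma upTo_succ (t : ℕ) (ω : ℕ → W) : upTo (t + 1) ω = (upTo t ω).snoc (ω (t + 1)) := by
  funext ⟨i, hi⟩
  rcases (Finset.mem_Iic.1 hi).lt_or_eq with hlt | rfl
  · simp [upTo, History.snoc, Nat.lt_succ_iff.1 hlt]
  · simp [upTo, History.snoc]

variable [MeasurableSpace W]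

lemma measurable_upTo (t : ℕ) : Measurable (upTo t : (ℕ → W) → History W t) :=
  measurable_pi_lambda _ fun i => measurable_pi_apply i.1

lemma measurable_upTo_prodMk (t : ℕ) :
    Measurable (fun ω : ℕ → W => (upTo t ω, ω (t + 1))) :=
  (measurable_upTo t).prodMk (measurable_pi_apply _)

lemma History.measurable_stopped : Measurable (History.stopped : History W t → ℕ → W) :=
  measurable_pi_lambda _ fun _ => measurable_pi_apply _

lemma History.measurable_snoc : Measurable (fun p : History W t × W => p.1.snoc p.2) := by
  refine measurable_pi_lambda _ fun i => ?_
  simp only [History.snoc]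
  split_ifs
  · exact (measurable_pi_apply _).comp measurable_fst
  · exact measurable_snd

end Histories

section PathLaw

variable {X Y : Type*} [MeasurableSpace X] [MeasurableSpace Y]
  {PX : Measure X} [IsProbabilityMeasure PX] {PY : Kernel Y Y} [IsMarkovKernel PY]
  {t s : ℕ} {w : History (X × Y) t}

instance isProbabilityMeasure_pathLaw : IsProbabilityMeasure (pathLaw PX PY t w) := by
  unfold pathLaw
  infer_instance

lemma stepKernel_apply (h : History (X × Y) s) :
    stepKernel PX PY s h = PX.prod (PY h.last.2) := by
  rw [stepKernel, Kernel.prod_apply, Kernel.const_apply, Kernel.comap_apply]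

lemma map_upTo_pathLaw : (pathLaw PX PY t w).map (upTo s) =
    Kernel.partialTraj (X := fun _ => X × Y) (stepKernel PX PY) t s w :=
  Kernel.traj_map_frestrictLe_apply (X := fun _ => X × Y) (κ := stepKernel PX PY) t s w

lemma map_upTo_self_pathLaw : (pathLaw PX PY t w).map (upTo t) = Measure.dirac w := by
  rw [map_upTo_pathLaw, Kernel.partialTraj_self, Kernel.id_apply]

lemma map_upTo_prodMk_pathLaw (hts : t ≤ s) :
    (pathLaw PX PY t w).map (fun ω => (upTo s ω, ω (s + 1))) =
      ((pathLaw PX PY t w).map (upTo s)) ⊗ₘ (stepKernel PX PY s) := by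
  rw [map_upTo_pathLaw]
  exact (Kernel.partialTraj_compProd_eq_map_traj (X := fun _ => X × Y)
    (κ := stepKernel PX PY) hts).symm

lemma integrable_comp_upTo_self {F : History (X × Y) t → ℝ} (hF : Measurable F) :
    Integrable (fun ω => F (upTo t ω)) (pathLaw PX PY t w) := by
  refine Integrable.comp_measurable ?_ (measurable_upTo t)
  rw [map_upTo_self_pathLaw]
  exact integrable_dirac' hF.stronglyMeasurable enorm_lt_top

lemma integral_comp_upTo_self {F : History (X × Y) t → ℝ} (hF : Measurable F) :
    ∫ ω, F (upTo t ω) ∂(pathLaw PX PY t w) = F w := by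
  rw [← integral_map (measurable_upTo t).aemeasurable hF.aestronglyMeasurable,
    map_upTo_self_pathLaw, integral_dirac' _ _ hF.stronglyMeasurable]

variable {G : History (X × Y) s × (X × Y) → ℝ}

lemma integrable_comp_upTo_prodMk_iff (hts : t ≤ s) (hG : Measurable G) :
    Integrable (fun ω => G (upTo s ω, ω (s + 1))) (pathLaw PX PY t w) ↔
      Integrable G (((pathLaw PX PY t w).map (upTo s)) ⊗ₘ (stepKernel PX PY s)) := by
  rw [← map_upTo_prodMk_pathLaw hts]
  exact (integrable_map_measure hG.aestronglyMeasurable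
    (measurable_upTo_prodMk s).aemeasurable).symm

lemma integrable_integral_stepKernel
    (hG : Integrable G (((pathLaw PX PY t w).map (upTo s)) ⊗ₘ (stepKernel PX PY s))) :
    Integrable (fun h => ∫ v, G (h, v) ∂(stepKernel PX PY s h))
      ((pathLaw PX PY t w).map (upTo s)) := by
  simpa using Integrable.integral_compProd hG

lemma integral_comp_upTo_prodMk (hts : t ≤ s) (hG : Measurable G)
    (hint : Integrable (fun ω => G (upTo s ω, ω (s + 1))) (pathLaw PX PY t w)) :
    ∫ ω, G (upTo s ω, ω (s + 1)) ∂(pathLaw PX PY t w) =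
      ∫ ω, ∫ v, G (upTo s ω, v) ∂(stepKernel PX PY s (upTo s ω)) ∂(pathLaw PX PY t w) := by
  have hcomp := (integrable_comp_upTo_prodMk_iff hts hG).1 hint
  rw [← integral_map (measurable_upTo_prodMk s).aemeasurable hG.aestronglyMeasurable,
    map_upTo_prodMk_pathLaw hts, Measure.integral_compProd hcomp,
    integral_map (measurable_upTo s).aemeasurable
      (integrable_integral_stepKernel hcomp).aestronglyMeasurable]

end PathLaw

/-- A real-valued plan assigning a number to every partial history, e.g. a consumption plan or a
sequence of utilities. -/
abbrev Plan (X Y : Type*) : Type _ := (s : ℕ) → History (X × Y) s → ℝ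

/-- A function assigning to every partial history a weight on the next `Y`-state; admissible
distortions are the ones satisfying `IsDistortion`. -/
abbrev RatioPlan (X Y : Type*) : Type _ := (s : ℕ) → History (X × Y) s → Y → ℝ

section CumRatio

variable {X Y : Type*} {m : RatioPlan X Y} {t n : ℕ}

/-- The random variable `(M_{t+n} / M_t) F(W^{t+n})`. -/
def weighted (m : RatioPlan X Y) (t n : ℕ) (F : History (X × Y) (t + n) → ℝ) (ω : ℕ → X × Y) : ℝ :=
  cumRatio m t n ω * F (upTo (t + n) ω)

/-- `(M_{t+n+1} / M_t) F(W^{t+n+1})` as a function of the pair `(W^{t+n}, W_{t+n+1})`. -/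
def weightedStep (m : RatioPlan X Y) (t n : ℕ) (F : History (X × Y) (t + n + 1) → ℝ)
    (p : History (X × Y) (t + n) × (X × Y)) : ℝ :=
  cumRatio m t n p.1.stopped * (m (t + n) p.1 p.2.2 * F (p.1.snoc p.2))

lemma cumRatio_stopped_upTo (ω : ℕ → X × Y) :
    cumRatio m t n (upTo (t + n) ω).stopped = cumRatio m t n ω := by
  refine Finset.prod_congr rfl fun i hi => ?_
  have hi := Finset.mem_range.1 hi
  rw [upTo_stopped_upTo (by lia), stopped_upTo_apply (by lia)]

lemma weightedStep_upTo {F : History (X × Y) (t + n + 1) → ℝ} (ω : ℕ → X × Y) :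
    weightedStep m t n F (upTo (t + n) ω, ω (t + n + 1)) = weighted m t (n + 1) F ω := by
  rw [weightedStep, cumRatio_stopped_upTo, ← upTo_succ, ← mul_assoc, weighted, cumRatio,
    cumRatio, Finset.prod_range_succ]
  rfl

variable [MeasurableSpace X] [MeasurableSpace Y] {PX : Measure X} [IsProbabilityMeasure PX]
  {PY : Kernel Y Y} {w : History (X × Y) t}

lemma cumRatio_nonneg (hm : IsDistortion PY m) (ω : ℕ → X × Y) : 0 ≤ cumRatio m t n ω :=
  Finset.prod_nonneg fun _ _ => (hm.mem _ _).1 _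

lemma measurable_cumRatio (hm : IsDistortion PY m) : Measurable (cumRatio m t n) :=
  Finset.measurable_prod _ fun _ _ => (hm.measurable _).comp
    ((measurable_upTo _).prodMk (measurable_pi_apply _).snd)

lemma measurable_weightedStep (hm : IsDistortion PY m) {F : History (X × Y) (t + n + 1) → ℝ}
    (hF : Measurable F) : Measurable (weightedStep m t n F) :=
  ((measurable_cumRatio hm).comp (History.measurable_stopped.comp measurable_fst)).mul
    (((hm.measurable _).comp (measurable_fst.prodMk measurable_snd.snd)).mul
      (hF.comp History.measurable_snoc))

variable [IsMarkovKernel PY]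

/-- The distorted conditional expectation `E[m_{s+1}(Y_{s+1} | w^s) F(W^{s+1}) | w^s]`. -/
def nextMean (PX : Measure X) [IsProbabilityMeasure PX] (PY : Kernel Y Y) [IsMarkovKernel PY]
    (m : RatioPlan X Y) (s : ℕ) (F : History (X × Y) (s + 1) → ℝ) (h : History (X × Y) s) : ℝ :=
  ∫ v, m s h v.2 * F (h.snoc v) ∂(stepKernel PX PY s h)

lemma integral_weightedStep {F : History (X × Y) (t + n + 1) → ℝ} (ω : ℕ → X × Y) :
    ∫ v, weightedStep m t n F (upTo (t + n) ω, v) ∂(stepKernel PX PY (t + n) (upTo (t + n) ω)) =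
      weighted m t n (nextMean PX PY m (t + n) F) ω := by
  simp only [weightedStep, cumRatio_stopped_upTo, integral_const_mul, weighted, nextMean]

lemma integrable_weighted_nextMean (hm : IsDistortion PY m) {F : History (X × Y) (t + n + 1) → ℝ}
    (hF : Measurable F) (hint : Integrable (weighted m t (n + 1) F) (pathLaw PX PY t w)) :
    Integrable (weighted m t n (nextMean PX PY m (t + n) F)) (pathLaw PX PY t w) := by
  simp only [← funext (weightedStep_upTo (m := m) (F := F))] at hint
  have hcomp := (integrable_comp_upTo_prodMk_iff (Nat.le_add_right t n)
    (measurable_weightedStep hm hF)).1 hint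
  simpa only [Function.comp_def, integral_weightedStep] using
    (integrable_integral_stepKernel hcomp).comp_measurable (measurable_upTo _)

lemma integral_weighted_succ (hm : IsDistortion PY m) {F : History (X × Y) (t + n + 1) → ℝ}
    (hF : Measurable F) (hint : Integrable (weighted m t (n + 1) F) (pathLaw PX PY t w)) :
    ∫ ω, weighted m t (n + 1) F ω ∂(pathLaw PX PY t w) =
      ∫ ω, weighted m t n (nextMean PX PY m (t + n) F) ω ∂(pathLaw PX PY t w) := by
  simp only [← funext (weightedStep_upTo (m := m) (F := F))] at hint ⊢
  simp only [integral_comp_upTo_prodMk (Nat.le_add_right t n) (measurable_weightedStep hm hF) hint,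
    integral_weightedStep]

lemma nextMean_one (hm : IsDistortion PY m) (s : ℕ) : nextMean PX PY m s 1 = 1 := by
  funext h
  simp only [nextMean, stepKernel_apply, Pi.one_apply, mul_one]
  rw [integral_fun_snd, probReal_univ, one_smul, (hm.mem s h).2]

variable [Finite Y] [MeasurableSingletonClass Y]

lemma integrable_weighted_one (hm : IsDistortion PY m) (n : ℕ) :
    Integrable (weighted m t n 1) (pathLaw PX PY t w) := by
  induction n with
  | zero => exact integrable_const (1 * 1)
  | succ n ih =>
    have hG : Measurable (weightedStep m t n 1) := measurable_weightedStep hm measurable_one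
    have hnonneg : ∀ p, 0 ≤ weightedStep m t n 1 p := fun p =>
      mul_nonneg (cumRatio_nonneg hm _) (mul_nonneg ((hm.mem _ _).1 _) zero_le_one)
    rw [← funext weightedStep_upTo, integrable_comp_upTo_prodMk_iff (Nat.le_add_right t n) hG,
      Measure.integrable_compProd_iff hG.aestronglyMeasurable]
    simp only [Real.norm_of_nonneg (hnonneg _)]
    refine ⟨.of_forall fun h => ?_, ?_⟩
    · rw [stepKernel_apply]
      have hmh : Integrable (m (t + n) h) (PY h.last.2) := .of_finite
      exact ((hmh.comp_snd PX).mul_const 1).const_mul (cumRatio m t n h.stopped)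
    · refine (integrable_map_measure
        hG.stronglyMeasurable.integral_kernel_prod_right'.aestronglyMeasurable
        (measurable_upTo _).aemeasurable).2 ?_
      simpa only [Function.comp_def, integral_weightedStep, nextMean_one hm] using ih

lemma integral_weighted_one (hm : IsDistortion PY m) (n : ℕ) :
    ∫ ω, weighted m t n 1 ω ∂(pathLaw PX PY t w) = 1 := by
  induction n with
  | zero => simp [weighted, cumRatio]
  | succ n ih =>
    rw [integral_weighted_succ hm measurable_one (integrable_weighted_one hm _),
      nextMean_one hm, ih]

lemma transversality_of_bounded {γ : ℝ} (hγ0 : 0 ≤ γ) (hγ1 : γ < 1) {U : Plan X Y}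
    (hU : ∀ s, Measurable (U s)) {K : ℝ} (hK : ∀ s h, |U s h| ≤ K) :
    Transversality PX PY γ U t w := by
  intro m hm
  have hbound : ∀ n ω, ‖weighted m t n (U (t + n)) ω‖ ≤ weighted m t n 1 ω * K := fun n ω => by
    rw [weighted, weighted, norm_mul, Real.norm_of_nonneg (cumRatio_nonneg hm ω), Pi.one_apply,
      mul_one]
    exact mul_le_mul_of_nonneg_left (hK _ _) (cumRatio_nonneg hm ω)
  have hint : ∀ n, Integrable (fun ω => weighted m t n 1 ω * K) (pathLaw PX PY t w) :=
    fun n => (integrable_weighted_one hm n).mul_const K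
  have hmean : ∀ n, ‖∫ ω, weighted m t n (U (t + n)) ω ∂(pathLaw PX PY t w)‖ ≤ K := fun n =>
    (norm_integral_le_of_norm_le (hint n) (.of_forall (hbound n))).trans_eq <| by
      rw [integral_mul_const, integral_weighted_one hm, one_mul]
  refine ⟨fun T => (hint (T + 1)).mono' ((measurable_cumRatio hm).mul
    ((hU _).comp (measurable_upTo _))).aestronglyMeasurable (.of_forall (hbound (T + 1))), ?_⟩
  have hpow : Tendsto (fun T : ℕ => γ ^ (T + 1)) atTop (𝓝 0) :=
    (tendsto_pow_atTop_nhds_zero_of_lt_one hγ0 hγ1).comp (tendsto_add_atTop_nat 1)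
  exact hpow.zero_mul_isBoundedUnder_le (isBoundedUnder_of ⟨K, fun T => hmean (T + 1)⟩)

end CumRatio

section Measurability

variable {X Y : Type*} [MeasurableSpace X] [MeasurableSpace Y] {PX : Measure X}
  [SFinite PX] {PY : Kernel Y Y} [IsSFiniteKernel PY] {θ : ℝ≥0∞} {U : Plan X Y} {s : ℕ}

lemma measurable_integral_last {F : History (X × Y) s → Y → ℝ}
    (hF : Measurable (Function.uncurry F)) :
    Measurable (fun h : History (X × Y) s => ∫ y', F h y' ∂(PY h.last.2)) :=
  (StronglyMeasurable.integral_kernel_prod_right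
    (κ := PY.comap (fun h : History (X × Y) s => h.last.2) (measurable_last s).snd)
    hF.stronglyMeasurable).measurable

lemma measurable_contUtility (hU : Measurable (U (s + 1))) :
    Measurable (Function.uncurry (contUtility PX U s)) := by
  have hsnoc : Measurable (fun q : (History (X × Y) s × Y) × X =>
      U (s + 1) (q.1.1.snoc (q.2, q.1.2))) :=
    hU.comp (History.measurable_snoc.comp
      (measurable_fst.fst.prodMk (measurable_snd.prodMk measurable_fst.snd)))
  exact (hsnoc.stronglyMeasurable.integral_prod_right' (ν := PX)).measurable

/-- The distortion that is worst, period by period, for an agent with continuation utilities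
`contUtility PX U`. -/
def worstDistortion (PX : Measure X) (PY : Kernel Y Y) (θ : ℝ≥0∞) (U : Plan X Y) : RatioPlan X Y :=
  fun s h => worstRatio PY θ (contUtility PX U s h) h.last.2

lemma measurable_worstDistortion (hU : Measurable (U (s + 1))) :
    Measurable (Function.uncurry (worstDistortion PX PY θ U s)) := by
  have hexp : Measurable (Function.uncurry fun (h : History (X × Y) s) (y' : Y) =>
      Real.exp (-(θ⁻¹.toReal * contUtility PX U s h y'))) :=
    ((measurable_contUtility hU).const_mul _).neg.exp
  exact hexp.div ((measurable_integral_last hexp).comp measurable_fst)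

lemma measurable_robustExpectation_contUtility (hU : Measurable (U (s + 1))) :
    Measurable (fun h : History (X × Y) s =>
      robustExpectation PY θ (contUtility PX U s h) h.last.2) := by
  have hw := measurable_worstDistortion (PX := PX) (PY := PY) (θ := θ) hU
  exact (measurable_integral_last (hw.mul (measurable_contUtility hU))).add
    ((measurable_integral_last (hw.mul hw.log)).const_mul _)

lemma isDistortion_worstDistortion {PY : Kernel Y Y} [IsMarkovKernel PY] [Finite Y]
    [MeasurableSingletonClass Y] (hU : ∀ s, Measurable (U s)) :
    IsDistortion PY (worstDistortion PX PY θ U) where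
  measurable s := measurable_worstDistortion (hU (s + 1))
  mem _ _ := worstRatio_mem_likelihoodRatios

end Measurability

section Bellman

variable {X Y : Type*} [MeasurableSpace X] [MeasurableSpace Y]

/-- The right-hand side of the functional problem, with its minimum evaluated by
`robustExpectation`, as an operator acting on `U`. -/
def bellmanOp (PX : Measure X) (PY : Kernel Y Y) (γ : ℝ) (θ : ℝ≥0∞) (c U : Plan X Y) :
    Plan X Y :=
  fun s h => c s h + γ * robustExpectation PY θ (contUtility PX U s h) h.last.2

lemma SatisfiesFP.eq_bellmanOp [Finite Y] [MeasurableSingletonClass Y] {PX : Measure X}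
    {PY : Kernel Y Y} [IsMarkovKernel PY] {γ : ℝ} {θ : ℝ≥0∞} {c U : Plan X Y}
    (hU : SatisfiesFP PX PY γ θ c U) (hθ : θ ≠ 0) (s : ℕ) (h : History (X × Y) s) :
    U s h = bellmanOp PX PY γ θ c U s h := by
  obtain ⟨v, hv, hUv⟩ := hU.bellman s h
  rw [hUv, bellmanOp, EReal.coe_injective (hv.unique (isLeast_robustExpectation hθ))]

end Bellman

section Verification

variable {X Y : Type*} [MeasurableSpace X] [MeasurableSpace Y] {PX : Measure X}
  [IsProbabilityMeasure PX] {PY : Kernel Y Y} [IsMarkovKernel PY] {γ : ℝ} {θ : ℝ≥0∞}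
  {c U : Plan X Y} {m : RatioPlan X Y} {t n : ℕ} {w : History (X × Y) t}

/-- The part of the utility `U_s` that is not the discounted mean of `U_{s+1}` under the
distortion `m`. -/
def netUtility (PX : Measure X) [IsProbabilityMeasure PX] (PY : Kernel Y Y) [IsMarkovKernel PY]
    (γ : ℝ) (U : Plan X Y) (m : RatioPlan X Y) (s : ℕ) (h : History (X × Y) s) : ℝ :=
  U s h - γ * nextMean PX PY m s (U (s + 1)) h

lemma Transversality.integrable (htr : Transversality PX PY γ U t w)
    (hU : ∀ s, Measurable (U s)) (hm : IsDistortion PY m) :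
    ∀ n, Integrable (weighted m t n (U (t + n))) (pathLaw PX PY t w)
  | 0 => (integrable_comp_upTo_self (hU t)).const_mul 1
  | n + 1 => (htr m hm).1 n

lemma weighted_netUtility : weighted m t n (netUtility PX PY γ U m (t + n)) = fun ω =>
    weighted m t n (U (t + n)) ω -
      γ * weighted m t n (nextMean PX PY m (t + n) (U (t + n + 1))) ω := by
  funext ω
  simp only [weighted, netUtility]
  ring

lemma Transversality.integrable_netUtility (htr : Transversality PX PY γ U t w)
    (hU : ∀ s, Measurable (U s)) (hm : IsDistortion PY m) (n : ℕ) :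
    Integrable (weighted m t n (netUtility PX PY γ U m (t + n))) (pathLaw PX PY t w) := by
  rw [weighted_netUtility]
  exact (htr.integrable hU hm n).sub
    ((integrable_weighted_nextMean hm (hU _) (htr.integrable hU hm (n + 1))).const_mul γ)

lemma Transversality.integral_netUtility (htr : Transversality PX PY γ U t w)
    (hU : ∀ s, Measurable (U s)) (hm : IsDistortion PY m) (n : ℕ) :
    ∫ ω, weighted m t n (netUtility PX PY γ U m (t + n)) ω ∂(pathLaw PX PY t w) =
      ∫ ω, weighted m t n (U (t + n)) ω ∂(pathLaw PX PY t w) -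
        γ * ∫ ω, weighted m t (n + 1) (U (t + n + 1)) ω ∂(pathLaw PX PY t w) := by
  have hsucc := htr.integrable hU hm (n + 1)
  rw [weighted_netUtility, integral_sub (htr.integrable hU hm n)
    ((integrable_weighted_nextMean hm (hU _) hsucc).const_mul γ), integral_const_mul,
    integral_weighted_succ hm (hU _) hsucc]

lemma Transversality.sum_integral_netUtility (htr : Transversality PX PY γ U t w)
    (hU : ∀ s, Measurable (U s)) (hm : IsDistortion PY m) (n : ℕ) :
    ∑ j ∈ Finset.range n,
        γ ^ j * ∫ ω, weighted m t j (netUtility PX PY γ U m (t + j)) ω ∂(pathLaw PX PY t w) =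
      U t w - γ ^ n * ∫ ω, weighted m t n (U (t + n)) ω ∂(pathLaw PX PY t w) := by
  have hstart : ∫ ω, weighted m t 0 (U t) ω ∂(pathLaw PX PY t w) = U t w := by
    simpa [weighted, cumRatio] using integral_comp_upTo_self (hU t)
  induction n with
  | zero => simp [hstart]
  | succ n ih =>
    rw [Finset.sum_range_succ, ih, htr.integral_netUtility hU hm, mul_sub, ← mul_assoc, ← pow_succ,
      sub_add_sub_cancel]
    rfl

lemma Transversality.tendsto_sum_netUtility (htr : Transversality PX PY γ U t w)
    (hU : ∀ s, Measurable (U s)) (hm : IsDistortion PY m) :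
    Tendsto (fun n => ∑ j ∈ Finset.range n,
      γ ^ j * ∫ ω, weighted m t j (netUtility PX PY γ U m (t + j)) ω ∂(pathLaw PX PY t w))
      atTop (𝓝 (U t w)) := by
  simp only [htr.sum_integral_netUtility hU hm]
  have hlim := (tendsto_add_atTop_iff_nat (f := fun n => γ ^ n *
    ∫ ω, weighted m t n (U (t + n)) ω ∂(pathLaw PX PY t w)) 1).1 (htr m hm).2
  simpa using hlim.const_sub (U t w)

lemma coe_sum_integral_weighted {f : Plan X Y}
    (hint : ∀ n, Integrable (weighted m t n (f (t + n))) (pathLaw PX PY t w)) (n : ℕ) :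
    ((∑ j ∈ Finset.range n,
        γ ^ j * ∫ ω, weighted m t j (f (t + j)) ω ∂(pathLaw PX PY t w) : ℝ) : EReal) =
      ∑ j ∈ Finset.range n, ((γ ^ j : ℝ) : EReal) * extExpect (pathLaw PX PY t w)
        (fun ω => (cumRatio m t j ω : EReal) * (f (t + j) (upTo (t + j) ω) : EReal)) := by
  rw [ereal_coe_sum]
  refine Finset.sum_congr rfl fun j _ => ?_
  rw [EReal.coe_mul, ← extExpect_coe (hint j)]
  simp only [weighted, EReal.coe_mul]

lemma le_seqObjective {f : Plan X Y} {v : ℝ} (hγ : 0 ≤ γ) (hm : IsDistortion PY m)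
    (hf : ∀ s h, (f s h : EReal) ≤ payoff PY γ θ c m s h)
    (hint : ∀ n, Integrable (weighted m t n (f (t + n))) (pathLaw PX PY t w))
    (hlim : Tendsto (fun n => ∑ j ∈ Finset.range n,
      γ ^ j * ∫ ω, weighted m t j (f (t + j)) ω ∂(pathLaw PX PY t w)) atTop (𝓝 v)) :
    (v : EReal) ≤ seqObjective PX PY γ θ c m t w := by
  rw [← (EReal.tendsto_coe.2 hlim).limsup_eq]
  refine limsup_le_limsup (.of_forall fun n => ?_)
  simp only [coe_sum_integral_weighted hint]
  refine Finset.sum_le_sum fun j _ => mul_le_mul_of_nonneg_left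
    (extExpect_mono fun ω => ?_) (EReal.coe_nonneg.2 (pow_nonneg hγ j))
  exact mul_le_mul_of_nonneg_left (hf _ _) (EReal.coe_nonneg.2 (cumRatio_nonneg hm ω))

lemma seqObjective_eq {f : Plan X Y} {v : ℝ}
    (hf : ∀ s h, payoff PY γ θ c m s h = (f s h : EReal))
    (hint : ∀ n, Integrable (weighted m t n (f (t + n))) (pathLaw PX PY t w))
    (hlim : Tendsto (fun n => ∑ j ∈ Finset.range n,
      γ ^ j * ∫ ω, weighted m t j (f (t + j)) ω ∂(pathLaw PX PY t w)) atTop (𝓝 v)) :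
    seqObjective PX PY γ θ c m t w = v := by
  simp only [← (EReal.tendsto_coe.2 hlim).limsup_eq, coe_sum_integral_weighted hint, seqObjective,
    hf]

variable [Finite Y] [MeasurableSingletonClass Y]

lemma nextMean_eq_integral_contUtility {F : Plan X Y} {s : ℕ} (hF : Measurable (F (s + 1)))
    {h : History (X × Y) s} (hint : ∀ y', Integrable (fun x => F (s + 1) (h.snoc (x, y'))) PX) :
    nextMean PX PY m s (F (s + 1)) h =
      ∫ y', m s h y' * contUtility PX F s h y' ∂(PY h.last.2) := by
  have hmeas : Measurable (fun v : X × Y => m s h v.2 * F (s + 1) (h.snoc v)) :=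
    ((measurable_of_finite (m s h)).comp measurable_snd).mul
      (hF.comp (History.measurable_snoc.comp measurable_prodMk_left))
  have hprod : Integrable (fun v : X × Y => m s h v.2 * F (s + 1) (h.snoc v))
      (PX.prod (PY h.last.2)) :=
    (integrable_prod_iff' hmeas.aestronglyMeasurable).2
      ⟨.of_forall fun y' => (hint y').const_mul (m s h y'), .of_finite⟩
  simp only [nextMean, stepKernel_apply, integral_prod_symm _ hprod, integral_const_mul,
    contUtility]

lemma SatisfiesFP.netUtility_eq (hU : SatisfiesFP PX PY γ θ c U) (hθ : θ ≠ 0) (s : ℕ)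
    (h : History (X × Y) s) :
    netUtility PX PY γ U m s h = c s h + γ *
      (robustExpectation PY θ (contUtility PX U s h) h.last.2 -
        ∫ y', m s h y' * contUtility PX U s h y' ∂(PY h.last.2)) := by
  rw [netUtility, nextMean_eq_integral_contUtility (hU.measurable _) (hU.integrable s h),
    hU.eq_bellmanOp hθ, bellmanOp, add_sub_assoc, mul_sub]

lemma SatisfiesFP.netUtility_le_payoff (hU : SatisfiesFP PX PY γ θ c U) (hγ : 0 ≤ γ) (hθ : θ ≠ 0)
    (hm : IsDistortion PY m) (s : ℕ) (h : History (X × Y) s) :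
    (netUtility PX PY γ U m s h : EReal) ≤ payoff PY γ θ c m s h := by
  rw [hU.netUtility_eq hθ, payoff, EReal.coe_add, EReal.coe_mul, EReal.coe_mul, mul_left_comm]
  exact add_le_add_right (mul_le_mul_of_nonneg_left (robustExpectation_sub_le hθ (hm.mem s h))
    (EReal.coe_nonneg.2 hγ)) _

lemma SatisfiesFP.payoff_worstDistortion (hU : SatisfiesFP PX PY γ θ c U) (hθ : θ ≠ 0) (s : ℕ)
    (h : History (X × Y) s) : payoff PY γ θ c (worstDistortion PX PY θ U) s h =
      (netUtility PX PY γ U (worstDistortion PX PY θ U) s h : EReal) := by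
  rw [hU.netUtility_eq hθ, payoff, EReal.coe_add, EReal.coe_mul, EReal.coe_mul, mul_left_comm,
    worstDistortion, robustExpectation_sub_worstRatio]

theorem SatisfiesFP.isSeqValue (hU : SatisfiesFP PX PY γ θ c U) (hγ : 0 ≤ γ) (hθ : θ ≠ 0)
    (htr : Transversality PX PY γ U t w) : IsSeqValue PX PY γ θ c t w (U t w) := by
  have hworst := isDistortion_worstDistortion (PX := PX) (PY := PY) (θ := θ) hU.measurable
  refine ⟨⟨_, hworst, Eq.symm ?_⟩, ?_⟩
  · exact seqObjective_eq (hU.payoff_worstDistortion hθ)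
      (htr.integrable_netUtility hU.measurable hworst)
      (htr.tendsto_sum_netUtility hU.measurable hworst)
  · rintro _ ⟨m, hm, rfl⟩
    exact le_seqObjective hγ hm (hU.netUtility_le_payoff hγ hθ hm)
      (htr.integrable_netUtility hU.measurable hm) (htr.tendsto_sum_netUtility hU.measurable hm)

end Verification

/-- Bounded plans under the supremum norm; a plan is read as a function on the set of all
histories. -/
abbrev BoundedPlan (X Y : Type*) : Type _ := lp (fun _ : Σ s, History (X × Y) s => ℝ) ∞

namespace BoundedPlan

variable {X Y : Type*}

/-- The plan underlying a bounded plan. -/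
def toPlan (f : BoundedPlan X Y) : Plan X Y := fun s h => f ⟨s, h⟩

lemma abs_toPlan_le (f : BoundedPlan X Y) (s : ℕ) (h : History (X × Y) s) :
    |f.toPlan s h| ≤ ‖f‖ :=
  lp.norm_apply_le_norm ENNReal.top_ne_zero f ⟨s, h⟩

variable [MeasurableSpace X] [MeasurableSpace Y]

/-- The bounded plans that are measurable in every period. -/
def measurablePlans (X Y : Type*) [MeasurableSpace X] [MeasurableSpace Y] : Set (BoundedPlan X Y) :=
  {f | ∀ s, Measurable (f.toPlan s)}

lemma isClosed_measurablePlans : IsClosed (measurablePlans X Y) := by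
  refine isClosed_of_closure_subset fun f hf s => ?_
  obtain ⟨g, hg, hlim⟩ := mem_closure_iff_seq_limit.1 hf
  refine measurable_of_tendsto_metrizable (fun n => hg n s) (tendsto_pi_nhds.2 fun h => ?_)
  exact ((lp.uniformContinuous_coe.continuous.tendsto f).comp hlim).apply_nhds ⟨s, h⟩

end BoundedPlan

section FixedPoint

variable {X Y : Type*} [MeasurableSpace X] [MeasurableSpace Y] {PX : Measure X} {PY : Kernel Y Y}
  {γ : ℝ} {θ : ℝ≥0∞} {c U V : Plan X Y} {s : ℕ} {h : History (X × Y) s}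

lemma integrable_snoc [IsFiniteMeasure PX] {K : ℝ} (hU : Measurable (U (s + 1)))
    (hK : ∀ h, |U (s + 1) h| ≤ K) (y' : Y) : Integrable (fun x => U (s + 1) (h.snoc (x, y'))) PX :=
  .of_bound (hU.comp (History.measurable_snoc.comp (measurable_const.prodMk
    (measurable_id.prodMk measurable_const)))).aestronglyMeasurable K (.of_forall fun _ => hK _)

lemma measurable_bellmanOp [SFinite PX] [IsSFiniteKernel PY] (hc : Measurable (c s))
    (hU : Measurable (U (s + 1))) : Measurable (bellmanOp PX PY γ θ c U s) :=
  hc.add ((measurable_robustExpectation_contUtility hU).const_mul γ)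

variable [IsProbabilityMeasure PX] [IsMarkovKernel PY] [Finite Y] [MeasurableSingletonClass Y]

lemma abs_bellmanOp_sub_le (hγ : 0 ≤ γ) (hθ : θ ≠ 0) {δ : ℝ}
    (hU : ∀ y', Integrable (fun x => U (s + 1) (h.snoc (x, y'))) PX)
    (hV : ∀ y', Integrable (fun x => V (s + 1) (h.snoc (x, y'))) PX)
    (hUV : ∀ h, |U (s + 1) h - V (s + 1) h| ≤ δ) :
    |bellmanOp PX PY γ θ c U s h - bellmanOp PX PY γ θ c V s h| ≤ γ * δ := by
  have hcont : ∀ y', |contUtility PX U s h y' - contUtility PX V s h y'| ≤ δ := fun y' => by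
    rw [contUtility, contUtility, ← integral_sub (hU y') (hV y')]
    simpa using norm_integral_le_of_norm_le_const (μ := PX) (.of_forall fun x =>
      (Real.norm_eq_abs _).trans_le (hUV (h.snoc (x, y'))))
  rw [bellmanOp, bellmanOp, add_sub_add_left_eq_sub, ← mul_sub, abs_mul, abs_of_nonneg hγ]
  exact mul_le_mul_of_nonneg_left (abs_robustExpectation_sub_le hθ hcont) hγ

lemma abs_bellmanOp_le (hγ : 0 ≤ γ) (hθ : θ ≠ 0) {K : ℝ} (hU : ∀ h, |U (s + 1) h| ≤ K) :
    |bellmanOp PX PY γ θ c U s h| ≤ |c s h| + γ * K := by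
  have hcont : ∀ y', |contUtility PX U s h y'| ≤ K := fun y' => by
    simpa [contUtility] using norm_integral_le_of_norm_le_const (μ := PX)
      (.of_forall fun x => (Real.norm_eq_abs _).trans_le (hU (h.snoc (x, y'))))
  have hrobust := abs_robustExpectation_sub_le (PY := PY) (y := h.last.2) (v := 0) hθ
    (by simpa using hcont)
  rw [robustExpectation_zero, sub_zero] at hrobust
  refine (abs_add_le _ _).trans (add_le_add_right ?_ _)
  rw [abs_mul, abs_of_nonneg hγ]
  exact mul_le_mul_of_nonneg_left hrobust hγ

theorem exists_bounded_satisfiesFP (hγ0 : 0 ≤ γ) (hγ1 : γ < 1) (hθ : θ ≠ 0)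
    (hc : ∀ s, Measurable (c s)) {C : ℝ} (hC : ∀ s h, |c s h| ≤ C) :
    ∃ U, SatisfiesFP PX PY γ θ c U ∧ ∃ K, ∀ s h, |U s h| ≤ K := by
  let B (f : BoundedPlan X Y) : BoundedPlan X Y :=
    ⟨fun i => bellmanOp PX PY γ θ c f.toPlan i.1 i.2, memℓp_infty ⟨C + γ * ‖f‖, by
      rintro _ ⟨⟨s, h⟩, rfl⟩
      exact (abs_bellmanOp_le hγ0 hθ (f.abs_toPlan_le _)).trans (add_le_add_left (hC s h) _)⟩⟩
  have hint {f : BoundedPlan X Y} (hf : f ∈ BoundedPlan.measurablePlans X Y) (s : ℕ)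
      (h : History (X × Y) s) (y' : Y) :
      Integrable (fun x => f.toPlan (s + 1) (h.snoc (x, y'))) PX :=
    integrable_snoc (hf _) (f.abs_toPlan_le _) y'
  have hmaps : Set.MapsTo B (BoundedPlan.measurablePlans X Y) (BoundedPlan.measurablePlans X Y) :=
    fun f hf s => measurable_bellmanOp (hc s) (hf (s + 1))
  have hcontr : ContractingWith ⟨γ, hγ0⟩ (hmaps.restrict B _ _) := by
    refine ⟨hγ1, LipschitzWith.of_dist_le_mul fun f g => ?_⟩
    rw [Subtype.dist_eq, Subtype.dist_eq, dist_eq_norm, dist_eq_norm]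
    exact lp.norm_le_of_forall_le (mul_nonneg hγ0 (norm_nonneg _)) fun i =>
      abs_bellmanOp_sub_le hγ0 hθ (hint f.2 _ _) (hint g.2 _ _) ((f.1 - g.1).abs_toPlan_le _)
  have hzero : (0 : BoundedPlan X Y) ∈ BoundedPlan.measurablePlans X Y := fun _ => measurable_const
  obtain ⟨f, hf, hfix, -⟩ := hcontr.exists_fixedPoint'
    BoundedPlan.isClosed_measurablePlans.isComplete hmaps hzero (edist_ne_top _ _)
  exact ⟨f.toPlan, ⟨hf, hint hf, fun s h => ⟨_, isLeast_robustExpectation hθ,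
    congrArg (fun g : BoundedPlan X Y => g.toPlan s h) hfix.symm⟩⟩, ‖f‖, f.abs_toPlan_le⟩

end FixedPoint

end

end MinAgent

open MinAgent in
theorem theoremS1_general {X Y : Type*} [MeasurableSpace X] [MeasurableSpace Y] [Finite Y]
    [MeasurableSingletonClass Y]
    (PX : Measure X) [IsProbabilityMeasure PX] (PY : Kernel Y Y) [IsMarkovKernel PY]
    (γ : ℝ) (hγ : 0 ≤ γ) (θ : ℝ≥0∞) (hθ : θ ≠ 0) (c : (s : ℕ) → History (X × Y) s → ℝ) :
    (γ < 1 → (∀ s, Measurable (c s)) → (∃ C : ℝ, ∀ s w, |c s w| ≤ C) →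
      ∀ U, SatisfiesSP PX PY γ θ c U → SatisfiesFP PX PY γ θ c U) ∧
    (∀ U, SatisfiesFP PX PY γ θ c U →
      ∀ t w, Transversality PX PY γ U t w → IsSeqValue PX PY γ θ c t w (U t w)) := by
  refine ⟨fun hγ1 hc ⟨C, hC⟩ U hU => ?_, fun U hU t w htr => hU.isSeqValue hγ hθ htr⟩
  obtain ⟨V, hV, K, hK⟩ :=
    exists_bounded_satisfiesFP (PX := PX) (PY := PY) (θ := θ) hγ hγ1 hθ hc hC
  have hVseq : SatisfiesSP PX PY γ θ c V := fun t w =>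
    hV.isSeqValue hγ hθ (transversality_of_bounded hγ hγ1 hV.measurable hK)
  have hUV : U = V := funext fun t => funext fun w =>
    EReal.coe_injective ((hU t w).unique (hVseq t w))
  exact hUV ▸ hV

theorem theoremS1 {X Y : Type*} [MeasurableSpace X] [MeasurableSpace Y] [Finite Y]
    [MeasurableSingletonClass Y]
    (PX : Measure X) [IsProbabilityMeasure PX] (PY : Kernel Y Y) [IsMarkovKernel PY]
    (γ : ℝ) (hγ0 : 0 < γ) (hγ1 : γ < 1) (θ : ℝ≥0∞) (hθ : 0 < θ)
    (c : (s : ℕ) → MinAgent.History (X × Y) s → ℝ) (hc : ∀ s, Measurable (c s))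
    (hcb : ∃ C : ℝ, ∀ s w, |c s w| ≤ C) :
    -- (a)
    (∀ U : (s : ℕ) → MinAgent.History (X × Y) s → ℝ, (∀ s, Measurable (U s)) →
      MinAgent.SatisfiesSP PX PY γ θ c U → MinAgent.SatisfiesFP PX PY γ θ c U) ∧
    -- (b), for all histories at once and then for a single history
    (∀ U : (s : ℕ) → MinAgent.History (X × Y) s → ℝ, MinAgent.SatisfiesFP PX PY γ θ c U →
      ((∀ t w, MinAgent.Transversality PX PY γ U t w) → MinAgent.SatisfiesSP PX PY γ θ c U) ∧
      (∀ t w, MinAgent.Transversality PX PY γ U t w →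
        MinAgent.IsSeqValue PX PY γ θ c t w (U t w))) := by
  obtain ⟨ha, hb⟩ := theoremS1_general PX PY γ hγ0.le θ hθ.ne' c
  exact ⟨fun U _ => ha hγ1 hc hcb U, fun U hU => ⟨fun htr t w => hb U hU t w (htr t w), hb U hU⟩⟩
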